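/- For $K,s\in\mathbb N$ and $r_1,\dots,r_s\in[K]=\{1,\dots,K\}$ let $\phi_K(r_1,\dots,r_s)=\#\{j\in[K]:\exists i,\ r_i=j\}$ be the number of nonempty bins, and let $\Phi_K(t)=\mathbb E\,\phi_K(Y_1,\dots,Y_t)$, where $Y_1,\dots,Y_t$ are independent and uniform on $[K]$. Random variables $X_1,\dots,X_R$ are called $q$-wise independent if every subfamily of at most $q$ of them is mutually independent. **Lemma (balls and bins).** There are a function $q:\mathbb N\to\mathbb N$ with $q(R)=\Theta((\log R)^A)$ as $R\to\infty$, for some $A\in\mathbb N$, and a universal constant $C$ such that the following holds for all $R,K\in\mathbb N$ with $R\le K/20$. Let $X_1,\dots,X_R$ be $q(R)$-wise independent random variables with values in $[K]$, on an arbitrary probability space, each uniformly distributed on $[K]$. Then $$\Pr\Big[\,\sup_{0\le t\le R}\big|\phi_K(X_1,\dots,X_t)-\Phi_K(t)\big|\le C\sqrt R\,\Big]\ \ge\ \frac34 .$$ -/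

import Mathlib

open MeasureTheory ProbabilityTheory Filter Asymptotics

/-- The number of nonempty bins after throwing `s` balls into the bins `Fin K`,
where the `i`-th ball lands in the bin `r i`. -/
def nonemptyBins {K s : ℕ} (r : Fin s → Fin K) : ℕ :=
  (Finset.univ.filter (fun j : Fin K => ∃ i, r i = j)).card

/-- The expected number of nonempty bins after throwing `t` independent uniform balls into
`K` bins: the average of `nonemptyBins` over the uniform distribution on `[K]^t`. -/
noncomputable def expectedNonemptyBins (K t : ℕ) : ℝ :=
  (∑ r : Fin t → Fin K, (nonemptyBins r : ℝ)) / (K : ℝ) ^ t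

/-- A family of random variables is `q`-wise independent if every subfamily of at most `q` of
them is (mutually) independent. -/
def QWiseIndep {Ω ι β : Type*} [MeasurableSpace Ω] [MeasurableSpace β]
    (q : ℕ) (X : ι → Ω → β) (μ : Measure Ω) : Prop :=
  ∀ s : Finset ι, s.card ≤ q → iIndepFun (fun i : s => X i) μ

/-! Let `D t` be the deviation of the occupancy from its mean. Ball `m` opens a new bin unless its
bin is already occupied, so `D t = -S t - (1/K) ∑_{i<t} D i`, where `S t` sums the centered
indicators `incr nonzeroInd` that ball `i` hits an occupied bin. As `R ≤ K/20`, a discrete Gronwall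
argument (`abs_occupancy_sub_le`) reduces the claim to `|S t| = O(√R)` for all `t ≤ R` at once.

Under full independence `S` is a martingale. To work with limited independence, the indicator of a
positive load is replaced by the inclusion-exclusion polynomial of degree `L`, with `L` of order
`log R`. Fourth powers of block sums then have degree at most `4(L+1)`, so their means equal those
under full independence (`wavg_eq_of_mem_lowDegree`), where the martingale property bounds them by
`O(n²)` for blocks of length `n`. The maximum over `t` is not of low degree, but
`exists_maximal_fourth_moment` needs only these block moments; fourth moments avoid the logarithmic
loss of a dyadic argument with second moments.

The truncation error is dominated by another polynomial, nonnegative on the naturals, whose mean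
also transfers. Loads have bounded exponential moments because `R ≤ K/20`, so each step costs
`O(2^(-L))`, and `2^L ≥ R` makes the total `O(1)`. Markov's inequality for the two errors finishes
the proof. -/

/-! ### The truncated inclusion-exclusion polynomial -/

/-- The inclusion-exclusion expansion of the indicator of `n ≠ 0`, truncated at degree `L`. -/
noncomputable def bonferroni (L : ℕ) (x : ℝ) : ℝ :=
  1 - ∏ k ∈ Finset.range L, (1 - x / ((k : ℝ) + 1))

/-- The factors are `(k - m)/(k + 1)`. Hence the truncation is exact at loads `1, …, L`. -/
lemma prod_one_sub_div (L m : ℕ) :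
    ∏ k ∈ Finset.range L, (1 - ((m + 1 : ℕ) : ℝ) / ((k : ℝ) + 1)) = (-1) ^ L * (m.choose L : ℝ) := by
  induction L with
  | zero => simp
  | succ L ih =>
    rw [Finset.prod_range_succ, ih]
    have hpos : ((L : ℝ) + 1) ≠ 0 := by positivity
    have key : (m.choose (L + 1) : ℝ) * ((L : ℝ) + 1) = (m.choose L : ℝ) * ((m : ℝ) - L) := by
      rcases le_or_gt L m with h | h
      · have := Nat.choose_succ_right_eq m L
        rw [← Nat.cast_sub h]
        exact_mod_cast this
      · rw [Nat.choose_eq_zero_of_lt h, Nat.choose_eq_zero_of_lt (h.trans (Nat.lt_succ_self L))]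
        simp
    rw [eq_div_of_mul_eq hpos key, pow_succ]
    push_cast
    field_simp
    ring

lemma bonferroni_zero (L : ℕ) : bonferroni L 0 = 0 := by
  simp [bonferroni]

lemma bonferroni_succ (L m : ℕ) :
    bonferroni L ((m + 1 : ℕ) : ℝ) = 1 - (-1) ^ L * (m.choose L : ℝ) := by
  rw [bonferroni, prod_one_sub_div]

lemma abs_bonferroni_le (L n : ℕ) : |bonferroni L (n : ℝ)| ≤ 2 ^ n := by
  cases n with
  | zero => simp [bonferroni_zero]
  | succ m =>
    rw [bonferroni_succ]
    have h1 : (m.choose L : ℝ) ≤ 2 ^ m := by exact_mod_cast Nat.choose_le_two_pow m L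
    have h2 : (1 : ℝ) ≤ 2 ^ m := one_le_pow₀ (by norm_num)
    calc |1 - (-1) ^ L * (m.choose L : ℝ)| ≤ |1| + |(-1) ^ L * (m.choose L : ℝ)| := abs_sub _ _
      _ = 1 + m.choose L := by simp [abs_mul, abs_pow]
      _ ≤ 2 ^ (m + 1) := by rw [pow_succ]; linarith

/-- A nonnegative polynomial that dominates the error of `bonferroni L` on the natural numbers. -/
noncomputable def bonferroniError (L : ℕ) (x : ℝ) : ℝ := x * (1 - bonferroni L x) ^ 2

lemma bonferroniError_nonneg (L n : ℕ) : 0 ≤ bonferroniError L (n : ℝ) := by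
  unfold bonferroniError; positivity

/-- The indicator of the nonzero reals. -/
noncomputable def nonzeroInd (x : ℝ) : ℝ := if x = 0 then 0 else 1

/-- At `m + 1` the error is the natural number `m.choose L`, which is at most its square. Squaring
removes the sign, and the factor `x` makes the dominating polynomial vanish at `0`. -/
lemma abs_nonzeroInd_sub_bonferroni_le (L n : ℕ) :
    |nonzeroInd (n : ℝ) - bonferroni L (n : ℝ)| ≤ bonferroniError L (n : ℝ) := by
  cases n with
  | zero => simp [nonzeroInd, bonferroni_zero, bonferroniError]
  | succ m =>
    rw [bonferroniError, bonferroni_succ, nonzeroInd, if_neg (by positivity)]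
    have h : (m.choose L : ℝ) ≤ (m.choose L : ℝ) ^ 2 := by
      exact_mod_cast Nat.le_self_pow two_ne_zero _
    have e : (1 - (1 - (-1 : ℝ) ^ L * (m.choose L : ℝ))) = (-1) ^ L * (m.choose L : ℝ) := by ring
    rw [e, mul_pow, ← pow_mul, mul_comm L 2, pow_mul, abs_mul, abs_pow]
    simp only [abs_neg, abs_one, one_pow, one_mul, Nat.abs_cast, even_two, Even.neg_pow]
    push_cast
    nlinarith [sq_nonneg (m.choose L : ℝ), (Nat.cast_nonneg m : (0 : ℝ) ≤ m)]

/-- The left side vanishes unless `n > L`; there a spare factor `2^m ≥ 2^L` pays for the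
denominator. -/
lemma bonferroniError_le (L n : ℕ) : bonferroniError L (n : ℝ) ≤ 16 ^ n / 2 ^ L := by
  cases n with
  | zero => simp [bonferroniError]
  | succ m =>
    rcases lt_or_ge m L with h | h
    · rw [bonferroniError, bonferroni_succ, Nat.choose_eq_zero_of_lt h]
      have : (0 : ℝ) ≤ 16 ^ (m + 1) / 2 ^ L := by positivity
      simpa using this
    · rw [bonferroniError, bonferroni_succ]
      have e : (1 - (1 - (-1 : ℝ) ^ L * (m.choose L : ℝ))) ^ 2 = (m.choose L : ℝ) ^ 2 := by
        rw [sub_sub_cancel, mul_pow, ← pow_mul, mul_comm L 2, pow_mul]; simp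
      have h1 : (m.choose L : ℝ) ≤ 2 ^ m := by exact_mod_cast Nat.choose_le_two_pow m L
      have h2 : ((m + 1 : ℕ) : ℝ) ≤ 2 ^ (m + 1) := by exact_mod_cast (Nat.lt_two_pow_self).le
      have h3 : (2 : ℝ) ^ L ≤ 2 ^ m := pow_le_pow_right₀ (by norm_num) h
      rw [e, le_div_iff₀ (by positivity)]
      calc ((m + 1 : ℕ) : ℝ) * (m.choose L : ℝ) ^ 2 * 2 ^ L
          ≤ 2 ^ (m + 1) * (2 ^ m) ^ 2 * 2 ^ m := by gcongr
        _ = 2 * (2 * 2 * 2 * 2) ^ m := by simp only [mul_pow]; ring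
        _ ≤ 16 ^ (m + 1) := by
          have : (0 : ℝ) < 16 ^ m := by positivity
          rw [pow_succ, show (2 : ℝ) * 2 * 2 * 2 = 16 by norm_num]
          linarith

/-! ### Weighted averages on a finite type -/

/-- The integral of `f` against the weights `w`. -/
def wavg {Γ : Type*} [Fintype Γ] (w f : Γ → ℝ) : ℝ := ∑ x, w x * f x

section wavg

variable {Γ : Type*} [Fintype Γ] {w : Γ → ℝ}

lemma wavg_add (f g : Γ → ℝ) : wavg w (fun x => f x + g x) = wavg w f + wavg w g := by
  simp [wavg, mul_add, Finset.sum_add_distrib]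

lemma wavg_const_mul (c : ℝ) (f : Γ → ℝ) : wavg w (fun x => c * f x) = c * wavg w f := by
  simp only [wavg, Finset.mul_sum]
  exact Finset.sum_congr rfl fun _ _ => by ring

lemma wavg_sum {ι : Type*} (s : Finset ι) (f : ι → Γ → ℝ) :
    wavg w (fun x => ∑ i ∈ s, f i x) = ∑ i ∈ s, wavg w (f i) := by
  simp only [wavg, Finset.mul_sum]
  exact Finset.sum_comm

lemma wavg_mono (hw : ∀ x, 0 ≤ w x) {f g : Γ → ℝ} (h : ∀ x, f x ≤ g x) :
    wavg w f ≤ wavg w g :=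
  Finset.sum_le_sum fun x _ => mul_le_mul_of_nonneg_left (h x) (hw x)

/-- A dyadic maximal inequality for partial sums whose fourth moments grow quadratically. -/
lemma exists_maximal_fourth_moment (hw : ∀ x, 0 ≤ w x) (M : ℕ → Γ → ℝ) (c : ℝ)
    (hM : ∀ a n : ℕ, wavg w (fun x => (∑ i ∈ Finset.Ico a (a + n), M i x) ^ 4) ≤ c * (n : ℝ) ^ 2)
    (h : ℕ) : ∀ a, ∃ G : Γ → ℝ,
      (∀ x, ∀ k ≤ 2 ^ h, (∑ i ∈ Finset.Ico a (a + k), M i x) ^ 4 ≤ G x) ∧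
      wavg w G ≤ 125 * c * 4 ^ h := by
  -- The coefficient of `b ^ 4` must stay below `3` for the dyadic recursion: with coefficient `2`,
  -- the costs `1` (left half), `1` (full left block) and `2` (right half) add up to the factor `4`
  -- in `4 ^ (h + 1)`.
  have key (a b : ℝ) : (a + b) ^ 4 ≤ 125 * a ^ 4 + 2 * b ^ 4 := by
    have h1 : (a + b) ^ 2 ≤ 5 * a ^ 2 + 5 / 4 * b ^ 2 := by nlinarith [sq_nonneg (2 * a - b / 2)]
    have h2 : ((a + b) ^ 2) ^ 2 ≤ (5 * a ^ 2 + 5 / 4 * b ^ 2) ^ 2 :=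
      pow_le_pow_left₀ (sq_nonneg _) h1 2
    have h3 : (5 * a ^ 2 + 5 / 4 * b ^ 2) ^ 2 ≤ 125 * a ^ 4 + 2 * b ^ 4 := by
      nlinarith [sq_nonneg (4 * a ^ 2 - b ^ 2 / 4), sq_nonneg (a ^ 2), sq_nonneg (b ^ 2)]
    calc (a + b) ^ 4 = ((a + b) ^ 2) ^ 2 := by ring
      _ ≤ _ := h2.trans h3
  have hc : 0 ≤ c := by
    have := hM 0 1
    simp only [Nat.cast_one, one_pow, mul_one] at this
    refine le_trans (Finset.sum_nonneg fun x _ => mul_nonneg (hw x) ?_) this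
    exact Even.pow_nonneg (by decide) _
  induction h with
  | zero =>
    intro a
    refine ⟨fun x => (∑ i ∈ Finset.Ico a (a + 1), M i x) ^ 4, fun x k hk => ?_, ?_⟩
    · rcases Nat.le_one_iff_eq_zero_or_eq_one.1 (by simpa using hk) with rfl | rfl
      · simp only [add_zero, Finset.Ico_self, Finset.sum_empty, ne_eq, OfNat.ofNat_ne_zero,
          not_false_eq_true, zero_pow]
        exact Even.pow_nonneg (by decide) _
      · exact le_rfl
    · refine (hM a 1).trans ?_
      norm_num
      linarith
  | succ h ih =>
    intro a
    obtain ⟨G₁, hG₁, hE₁⟩ := ih a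
    obtain ⟨G₂, hG₂, hE₂⟩ := ih (a + 2 ^ h)
    refine ⟨fun x => G₁ x + (125 * (∑ i ∈ Finset.Ico a (a + 2 ^ h), M i x) ^ 4 + 2 * G₂ x),
      fun x k hk => ?_, ?_⟩
    · have n₁ : 0 ≤ G₁ x := le_trans (by positivity) (hG₁ x 0 (Nat.zero_le _))
      have n₂ : 0 ≤ G₂ x := le_trans (by positivity) (hG₂ x 0 (Nat.zero_le _))
      rcases le_total k (2 ^ h) with hk' | hk'
      · have := hG₁ x k hk'
        have : 0 ≤ (∑ i ∈ Finset.Ico a (a + 2 ^ h), M i x) ^ 4 := by positivity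
        linarith
      · obtain ⟨l, rfl⟩ := Nat.exists_eq_add_of_le hk'
        have hl : l ≤ 2 ^ h := by rw [pow_succ] at hk; omega
        have := hG₂ x l hl
        rw [← add_assoc, ← Finset.sum_Ico_consecutive (fun i => M i x) (n := a + 2 ^ h)
          (Nat.le_add_right _ _) (Nat.le_add_right _ _)]
        have := key (∑ i ∈ Finset.Ico a (a + 2 ^ h), M i x)
          (∑ i ∈ Finset.Ico (a + 2 ^ h) (a + 2 ^ h + l), M i x)
        linarith
    · rw [wavg_add, wavg_add, wavg_const_mul, wavg_const_mul]
      have h3 := hM a (2 ^ h)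
      have e : (((2 ^ h : ℕ) : ℝ)) ^ 2 = 4 ^ h := by
        push_cast; rw [← pow_mul, mul_comm, pow_mul]; norm_num
      rw [e] at h3
      rw [pow_succ]
      linarith

end wavg

/-! ### Uniform averages over configurations -/

section uniform

variable {R K : ℕ}

/-- The uniform weights on `[K]^R`. -/
noncomputable def unif (R K : ℕ) : (Fin R → Fin K) → ℝ := fun _ => 1 / (K : ℝ) ^ R

lemma unif_nonneg (r : Fin R → Fin K) : 0 ≤ unif R K r := by unfold unif; positivity

lemma wavg_unif_prod (h : Fin R → Fin K → ℝ) :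
    wavg (unif R K) (fun r => ∏ i, h i (r i)) = ∏ i, (∑ j, h i j) / (K : ℝ) := by
  rw [Finset.prod_div_distrib, Finset.prod_univ_sum, Fintype.piFinset_univ]
  simp [wavg, unif, ← Finset.mul_sum, div_eq_inv_mul]

/-- Averaging over a coordinate `m` on which `F` depends only through its first argument. -/
lemma wavg_unif_coord (hK : 0 < K) (m : Fin R) (F : Fin K → (Fin R → Fin K) → ℝ)
    (hF : ∀ j r a, F j (Function.update r m a) = F j r) :
    wavg (unif R K) (fun r => F (r m) r) =
      wavg (unif R K) (fun r => (1 / (K : ℝ)) * ∑ j, F j r) := by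
  have hK' : (K : ℝ) ≠ 0 := by positivity
  -- Resampling: exchanging coordinate `m` with an independent uniform copy preserves the uniform
  -- measure.
  let σ : (Fin R → Fin K) × Fin K ≃ (Fin R → Fin K) × Fin K :=
    Function.Involutive.toPerm (fun p => (Function.update p.1 m p.2, p.1 m))
      (fun p => by simp)
  have h1 : ∑ p : (Fin R → Fin K) × Fin K, F p.2 p.1 =
      ∑ p : (Fin R → Fin K) × Fin K, F (p.1 m) p.1 := by
    rw [← Equiv.sum_comp σ]
    exact Finset.sum_congr rfl fun p _ => hF _ _ _
  rw [Fintype.sum_prod_type, Fintype.sum_prod_type] at h1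
  simp only [wavg, unif, ← Finset.mul_sum, h1]
  simp only [Finset.sum_const, Finset.card_univ, Fintype.card_fin, nsmul_eq_mul, ← Finset.mul_sum]
  field_simp

/-- The number of balls among the first `m` that land in bin `j`. -/
def load (r : Fin R → Fin K) (j : Fin K) (m : ℕ) : ℕ :=
  (Finset.univ.filter (fun i : Fin R => i.val < m ∧ r i = j)).card

lemma load_update (r : Fin R → Fin K) (j a : Fin K) (m : Fin R) {n : ℕ} (hn : n ≤ m) :
    load (Function.update r m a) j n = load r j n := by
  unfold load
  congr 1
  refine Finset.filter_congr fun i _ => and_congr_right fun hi => ?_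
  rw [Function.update_of_ne (by rintro rfl; omega)]

/-- Each ball contributes a factor of mean at most `1 + 15/K`, and `15 R / K ≤ 1`. The base `16`
serves both `bonferroniError` and the fourth power of `|bonferroni| ≤ 2^n`. -/
lemma wavg_unif_pow_load_le (hK : 0 < K) (hRK : (R : ℝ) ≤ (K : ℝ) / 20) (j : Fin K) (m : ℕ) :
    wavg (unif R K) (fun r => (16 : ℝ) ^ load r j m) ≤ 3 := by
  have hK' : (0 : ℝ) < K := by positivity
  have e (r : Fin R → Fin K) : (16 : ℝ) ^ load r j m =
      ∏ i : Fin R, if i.val < m ∧ r i = j then (16 : ℝ) else 1 := by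
    rw [load, ← Finset.prod_const, Finset.prod_filter]
  simp only [e]
  rw [wavg_unif_prod (fun i a => if i.val < m ∧ a = j then (16 : ℝ) else 1)]
  have h1 (i : Fin R) : (∑ a, if i.val < m ∧ a = j then (16 : ℝ) else 1) / (K : ℝ)
      ≤ Real.exp (15 / K) := by
    have : (∑ a, if i.val < m ∧ a = j then (16 : ℝ) else 1) ≤
        ∑ a : Fin K, (1 + if a = j then (15 : ℝ) else 0) := by
      refine Finset.sum_le_sum fun a _ => ?_
      by_cases ha : a = j <;> by_cases hi : i.val < m <;> simp [ha, hi]; norm_num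
    rw [Finset.sum_add_distrib] at this
    simp only [Finset.sum_const, Finset.card_univ, Fintype.card_fin, nsmul_eq_mul, mul_one,
      Finset.sum_ite_eq', Finset.mem_univ, if_true] at this
    calc _ ≤ ((K : ℝ) + 15) / K := by gcongr
      _ = 15 / K + 1 := by field_simp; ring
      _ ≤ _ := Real.add_one_le_exp _
  calc _ ≤ ∏ _i : Fin R, Real.exp (15 / K) := by
        refine Finset.prod_le_prod (fun i _ => ?_) fun i _ => h1 i
        refine div_nonneg (Finset.sum_nonneg fun a _ => ?_) hK'.le
        split_ifs <;> norm_num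
    _ = Real.exp (R * (15 / K)) := by
        rw [Finset.prod_const, Finset.card_univ, Fintype.card_fin, ← Real.exp_nat_mul]
    _ ≤ Real.exp 1 := by
        refine Real.exp_le_exp.2 ?_
        rw [mul_div_assoc', div_le_one hK']
        linarith
    _ ≤ 3 := Real.exp_one_lt_three.le

/-- The centered increment at time `m` of the sum of `T (load)` over the bins that are hit. -/
noncomputable def incr (T : ℝ → ℝ) (m : ℕ) (r : Fin R → Fin K) : ℝ :=
  if h : m < R then T (load r (r ⟨m, h⟩) m) - 1 / (K : ℝ) * ∑ j, T (load r j m) else 0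

lemma incr_update (T : ℝ → ℝ) {n : ℕ} (m : Fin R) (hn : n < m) (r : Fin R → Fin K) (a : Fin K) :
    incr T n (Function.update r m a) = incr T n r := by
  unfold incr
  have h : n < R := hn.trans m.2
  have hne : (⟨n, h⟩ : Fin R) ≠ m := by rintro rfl; simp at hn
  simp only [dif_pos h, load_update r _ a m hn.le, Function.update_of_ne hne]

/-- Increments are martingale differences under the uniform weights. -/
lemma wavg_unif_mul_incr (hK : 0 < K) (T : ℝ → ℝ) (m : ℕ) (g : (Fin R → Fin K) → ℝ)
    (hg : ∀ (h : m < R) r a, g (Function.update r ⟨m, h⟩ a) = g r) :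
    wavg (unif R K) (fun r => g r * incr T m r) = 0 := by
  by_cases h : m < R
  · have hK' : (K : ℝ) ≠ 0 := by positivity
    have := wavg_unif_coord hK ⟨m, h⟩
      (fun j r => g r * (T (load r j m) - 1 / (K : ℝ) * ∑ j, T (load r j m)))
      (fun j r a => by simp only [hg h, load_update r _ a ⟨m, h⟩ le_rfl])
    simp only [incr, dif_pos h]
    rw [this, wavg]
    refine Finset.sum_eq_zero fun r _ => ?_
    rw [← Finset.mul_sum, Finset.sum_sub_distrib]
    simp only [Finset.sum_const, Finset.card_univ, Fintype.card_fin, nsmul_eq_mul]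
    rw [← mul_assoc (K : ℝ), mul_one_div_cancel hK', one_mul, sub_self]
    simp
  · simp [incr, h, wavg]

lemma wavg_unif_sum_coord_le (hK : 0 < K) (hRK : (R : ℝ) ≤ (K : ℝ) / 20) (f : ℝ → ℝ) (c : ℝ)
    (hc : 0 ≤ c) (hf : ∀ n : ℕ, f n ≤ c * 16 ^ n) (m : Fin R) :
    wavg (unif R K) (fun r => f (load r (r m) m) + 1 / (K : ℝ) * ∑ j, f (load r j m)) ≤ 6 * c := by
  have hK' : (0 : ℝ) < K := by positivity
  rw [wavg_add, wavg_unif_coord hK m (fun j r => f (load r j m))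
    (fun j r a => by rw [load_update r _ a m le_rfl]), wavg_const_mul, wavg_sum]
  have h (j : Fin K) : wavg (unif R K) (fun r => f (load r j m)) ≤ 3 * c := by
    calc _ ≤ wavg (unif R K) (fun r => c * (16 : ℝ) ^ load r j m) :=
          wavg_mono unif_nonneg fun r => hf _
      _ = c * wavg (unif R K) (fun r => (16 : ℝ) ^ load r j m) := wavg_const_mul _ _
      _ ≤ c * 3 := mul_le_mul_of_nonneg_left (wavg_unif_pow_load_le hK hRK j m) hc
      _ = 3 * c := mul_comm _ _
  have h2 : 1 / (K : ℝ) * ∑ j, wavg (unif R K) (fun r => f (load r j m)) ≤ 3 * c := by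
    calc _ ≤ 1 / (K : ℝ) * ∑ _j : Fin K, 3 * c := by gcongr with j; exact h j
      _ = 3 * c := by
        simp only [Finset.sum_const, Finset.card_univ, Fintype.card_fin, nsmul_eq_mul]
        field_simp
  linarith

lemma wavg_unif_incr_pow_four_le (hK : 0 < K) (hRK : (R : ℝ) ≤ (K : ℝ) / 20) (L m : ℕ) :
    wavg (unif R K) (fun r => incr (bonferroni L) m r ^ 4) ≤ 48 := by
  have hK' : (0 : ℝ) < K := by positivity
  by_cases h : m < R
  · refine le_trans ?_ ((wavg_const_mul 8 _).trans_le (mul_le_mul_of_nonneg_left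
      (wavg_unif_sum_coord_le hK hRK (fun x => bonferroni L x ^ 4) 1 zero_le_one
        (fun n => ?_) ⟨m, h⟩) (by norm_num : (0:ℝ) ≤ 8))) |>.trans (by norm_num)
    · refine wavg_mono unif_nonneg fun r => ?_
      simp only [incr, dif_pos h]
      set x := bonferroni L (load r (r ⟨m, h⟩) m)
      -- Jensen's inequality for the fourth power.
      have hy : (1 / (K : ℝ) * ∑ j, bonferroni L (load r j m)) ^ 4 ≤
          1 / (K : ℝ) * ∑ j, bonferroni L (load r j m) ^ 4 := by
        have hJ := (Even.convexOn_pow (𝕜 := ℝ) (n := 4) (by decide)).map_sum_le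
          (t := (Finset.univ : Finset (Fin K))) (w := fun _ => 1 / (K : ℝ))
          (p := fun j => bonferroni L (load r j m)) (fun _ _ => by positivity)
          (by simp [hK'.ne']) (fun _ _ => Set.mem_univ _)
        simpa only [smul_eq_mul, ← Finset.mul_sum] using hJ
      set y := 1 / (K : ℝ) * ∑ j, bonferroni L (load r j m)
      have h1 : (x - y) ^ 2 ≤ 2 * x ^ 2 + 2 * y ^ 2 := by nlinarith [sq_nonneg (x + y)]
      have h2 : ((x - y) ^ 2) ^ 2 ≤ (2 * x ^ 2 + 2 * y ^ 2) ^ 2 :=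
        pow_le_pow_left₀ (sq_nonneg _) h1 2
      have h3 : (2 * x ^ 2 + 2 * y ^ 2) ^ 2 ≤ 8 * (x ^ 4 + y ^ 4) := by
        nlinarith [sq_nonneg (x ^ 2 - y ^ 2)]
      calc (x - y) ^ 4 = ((x - y) ^ 2) ^ 2 := by ring
        _ ≤ 8 * (x ^ 4 + y ^ 4) := h2.trans h3
        _ ≤ _ := by gcongr
    · rw [one_mul]
      calc bonferroni L n ^ 4 = |bonferroni L n| ^ 4 := by rw [Even.pow_abs (by decide)]
        _ ≤ (2 ^ n) ^ 4 := pow_le_pow_left₀ (abs_nonneg _) (abs_bonferroni_le L n) 4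
        _ = 16 ^ n := by rw [← pow_mul, mul_comm, pow_mul]; norm_num
  · simp [incr, h, wavg]

/-- Induction on the block length: the term linear in the new increment averages to zero, and the
others cost `O(n)` per step. -/
lemma wavg_unif_sum_incr_pow_four_le (hK : 0 < K) (hRK : (R : ℝ) ≤ (K : ℝ) / 20) (L a n : ℕ) :
    wavg (unif R K) (fun r => (∑ i ∈ Finset.Ico a (a + n), incr (bonferroni L) i r) ^ 4) ≤
      768 * (n : ℝ) ^ 2 := by
  induction n with
  | zero => simp [wavg]
  | succ n ih =>
    rcases Nat.eq_zero_or_pos n with rfl | hn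
    · have := wavg_unif_incr_pow_four_le hK hRK L a
      simp only [zero_add, Nat.Ico_succ_singleton, Finset.sum_singleton]
      push_cast
      linarith
    have hn' : (0 : ℝ) < n := by positivity
    have hM := wavg_unif_incr_pow_four_le hK hRK L (a + n)
    have hz := wavg_unif_mul_incr (R := R) hK (bonferroni L) (a + n)
      (fun r => (∑ i ∈ Finset.Ico a (a + n), incr (bonferroni L) i r) ^ 3) (fun h r b => by
        have e := Finset.sum_congr (rfl : Finset.Ico a (a + n) = _) fun i hi =>
          incr_update (bonferroni L) ⟨a + n, h⟩ (Finset.mem_Ico.1 hi).2 r b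
        simp only [e])
    -- The weight `1/n` in Young's inequality is chosen so that `(1 + 1/n) n² = n² + n`. The
    -- remaining cost `48 (16 n + 3)` fits into the growth of `768 (n + 1)²` because `768 = 16 *
    -- 48`.
    have hpt (x y : ℝ) : (x + y) ^ 4 ≤
        (1 + 1 / (n : ℝ)) * x ^ 4 + (4 * (x ^ 3 * y) + (16 * n + 3) * y ^ 4) := by
      have h1 : 8 * (x ^ 2 * y ^ 2) ≤ 1 / (n : ℝ) * x ^ 4 + 16 * n * y ^ 4 := by
        have : 0 ≤ 1 / (n : ℝ) * (x ^ 2 - 4 * n * y ^ 2) ^ 2 := by positivity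
        have e : 1 / (n : ℝ) * (x ^ 2 - 4 * n * y ^ 2) ^ 2 =
            1 / (n : ℝ) * x ^ 4 + 16 * n * y ^ 4 - 8 * (x ^ 2 * y ^ 2) := by field_simp; ring
        linarith
      have h2 : 4 * (x * y ^ 3) ≤ 2 * (x ^ 2 * y ^ 2) + 2 * y ^ 4 := by
        nlinarith [sq_nonneg (x * y - y ^ 2)]
      have e : (x + y) ^ 4 = x ^ 4 + 4 * (x ^ 3 * y) + 6 * (x ^ 2 * y ^ 2) + 4 * (x * y ^ 3) + y ^ 4 := by
        ring
      rw [e]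
      linarith
    have := wavg_mono (w := unif R K) unif_nonneg fun r =>
      hpt (∑ i ∈ Finset.Ico a (a + n), incr (bonferroni L) i r) (incr (bonferroni L) (a + n) r)
    rw [wavg_add, wavg_add, wavg_const_mul, wavg_const_mul, wavg_const_mul, hz] at this
    simp only [← add_assoc, Finset.sum_Ico_succ_top (Nat.le_add_right a n)]
    refine this.trans ?_
    have e1 : (1 + 1 / (n : ℝ)) * (768 * (n : ℝ) ^ 2) = 768 * (n : ℝ) ^ 2 + 768 * n := by
      field_simp
    have h1 := mul_le_mul_of_nonneg_left ih (by positivity : 0 ≤ 1 + 1 / (n : ℝ))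
    have h2 := mul_le_mul_of_nonneg_left hM (by positivity : (0 : ℝ) ≤ 16 * n + 3)
    push_cast
    linarith

end uniform

section lowDegree

variable {R K : ℕ}

/-! ### Functions of low degree -/

/-- The span of the product functions that depend on at most `d` coordinates. -/
def lowDegree (R K d : ℕ) : Submodule ℝ ((Fin R → Fin K) → ℝ) :=
  Submodule.span ℝ {f | ∃ (h : Fin R → Fin K → ℝ) (s : Finset (Fin R)),
    s.card ≤ d ∧ (∀ i ∉ s, h i = 1) ∧ f = fun r => ∏ i, h i (r i)}

lemma lowDegree_mono {d e : ℕ} (hde : d ≤ e) : lowDegree R K d ≤ lowDegree R K e :=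
  Submodule.span_mono fun _ ⟨h, s, hs, hh, hf⟩ => ⟨h, s, hs.trans hde, hh, hf⟩

lemma mul_mem_lowDegree {d e : ℕ} {f g : (Fin R → Fin K) → ℝ} (hf : f ∈ lowDegree R K d)
    (hg : g ∈ lowDegree R K e) : (fun r => f r * g r) ∈ lowDegree R K (d + e) := by
  have := Submodule.mul_mem_mul hf hg
  rw [lowDegree, lowDegree, Submodule.span_mul_span] at this
  refine Submodule.span_mono ?_ this
  rintro _ ⟨_, ⟨h, s, hs, hh, rfl⟩, _, ⟨k, t, ht, hk, rfl⟩, rfl⟩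
  refine ⟨fun i => h i * k i, s ∪ t, (Finset.card_union_le _ _).trans (add_le_add hs ht),
    fun i hi => ?_, ?_⟩
  · rw [Finset.mem_union, not_or] at hi
    simp only [hh i hi.1, hk i hi.2, one_mul]
  · ext r
    simp [Finset.prod_mul_distrib]

lemma const_mem_lowDegree (c : ℝ) (d : ℕ) : (fun _ => c) ∈ lowDegree R K d := by
  have h : (fun _ => (1 : ℝ)) ∈ lowDegree R K d :=
    Submodule.subset_span ⟨fun _ => 1, ∅, by simp, fun _ _ => rfl, by simp⟩
  have := (lowDegree R K d).smul_mem c h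
  convert this using 1
  ext r
  simp

lemma const_mul_mem_lowDegree (c : ℝ) {d : ℕ} {f : (Fin R → Fin K) → ℝ}
    (hf : f ∈ lowDegree R K d) : (fun r => c * f r) ∈ lowDegree R K d :=
  (lowDegree R K d).smul_mem c hf

lemma sum_mem_lowDegree {ι : Type*} (s : Finset ι) {d : ℕ} {f : ι → (Fin R → Fin K) → ℝ}
    (hf : ∀ i ∈ s, f i ∈ lowDegree R K d) : (fun r => ∑ i ∈ s, f i r) ∈ lowDegree R K d := by
  have := (lowDegree R K d).sum_mem hf
  convert this using 1
  ext r
  simp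

lemma pow_mem_lowDegree {d : ℕ} {f : (Fin R → Fin K) → ℝ} (hf : f ∈ lowDegree R K d) (n : ℕ) :
    (fun r => f r ^ n) ∈ lowDegree R K (n * d) := by
  induction n with
  | zero => simpa using const_mem_lowDegree 1 _
  | succ n ih =>
    simp only [pow_succ, Nat.succ_mul]
    exact mul_mem_lowDegree ih hf

lemma indicator_mem_lowDegree (i : Fin R) (j : Fin K) :
    (fun r => if r i = j then (1 : ℝ) else 0) ∈ lowDegree R K 1 := by
  refine Submodule.subset_span ⟨Function.update 1 i (fun a => if a = j then 1 else 0), {i},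
    by simp, fun k hk => ?_, ?_⟩
  · rw [Function.update_of_ne (by simpa using hk)]
    rfl
  · ext r
    rw [Finset.prod_eq_single i (fun k _ hk => by rw [Function.update_of_ne hk]; rfl) (by simp)]
    simp

lemma load_mem_lowDegree (j : Fin K) (m : ℕ) :
    (fun r => (load r j m : ℝ)) ∈ lowDegree R K 1 := by
  have e (r : Fin R → Fin K) : (load r j m : ℝ) =
      ∑ i : Fin R with i.val < m, if r i = j then (1 : ℝ) else 0 := by
    rw [load, ← Finset.filter_filter]
    simp
  simp only [e]
  exact sum_mem_lowDegree _ fun i _ => indicator_mem_lowDegree i j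

/-- Splitting according to the value of `r i` costs a single extra coordinate, however many bins
there are. -/
lemma coord_mem_lowDegree {d : ℕ} (i : Fin R) {f : Fin K → (Fin R → Fin K) → ℝ}
    (hf : ∀ j, f j ∈ lowDegree R K d) : (fun r => f (r i) r) ∈ lowDegree R K (d + 1) := by
  have e (r : Fin R → Fin K) : f (r i) r = ∑ j, f j r * (if r i = j then (1 : ℝ) else 0) := by
    simp
  simp only [e]
  exact sum_mem_lowDegree _ fun j _ => mul_mem_lowDegree (hf j) (indicator_mem_lowDegree i j)

lemma one_sub_bonferroni_mem_lowDegree (L : ℕ) (j : Fin K) (m : ℕ) :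
    (fun r => 1 - bonferroni L (load r j m)) ∈ lowDegree R K L := by
  simp only [bonferroni, sub_sub_cancel]
  induction L with
  | zero => simpa using const_mem_lowDegree 1 0
  | succ L ih =>
    simp only [Finset.prod_range_succ]
    refine mul_mem_lowDegree ih ?_
    simp only [div_eq_inv_mul]
    exact (lowDegree R K 1).sub_mem (const_mem_lowDegree 1 1)
      (const_mul_mem_lowDegree _ (load_mem_lowDegree j m))

lemma bonferroni_mem_lowDegree (L : ℕ) (j : Fin K) (m : ℕ) :
    (fun r => bonferroni L (load r j m)) ∈ lowDegree R K L := by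
  have := (lowDegree R K L).sub_mem (const_mem_lowDegree 1 L)
    (one_sub_bonferroni_mem_lowDegree L j m)
  convert this using 1
  ext r
  simp

lemma bonferroniError_mem_lowDegree (L : ℕ) (j : Fin K) (m : ℕ) :
    (fun r => bonferroniError L (load r j m)) ∈ lowDegree R K (1 + 2 * L) :=
  mul_mem_lowDegree (load_mem_lowDegree j m)
    (pow_mem_lowDegree (one_sub_bonferroni_mem_lowDegree L j m) 2)

lemma incr_bonferroni_mem_lowDegree (L m : ℕ) :
    incr (bonferroni L) m ∈ lowDegree R K (L + 1) := by
  by_cases h : m < R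
  · have e : incr (R := R) (K := K) (bonferroni L) m = fun r =>
        bonferroni L (load r (r ⟨m, h⟩) m) - 1 / (K : ℝ) * ∑ j, bonferroni L (load r j m) := by
      ext r
      simp only [incr, dif_pos h]
    rw [e]
    exact (lowDegree R K _).sub_mem
      (coord_mem_lowDegree ⟨m, h⟩ fun j => bonferroni_mem_lowDegree L j m)
      (const_mul_mem_lowDegree _ (sum_mem_lowDegree _ fun j _ =>
        lowDegree_mono (Nat.le_succ L) (bonferroni_mem_lowDegree L j m)))
  · have e : incr (R := R) (K := K) (bonferroni L) m = fun _ => 0 := by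
      ext r
      simp only [incr, dif_neg h]
    rw [e]
    exact const_mem_lowDegree 0 _

/-- A bound for the difference of the increments of the occupancy and of its truncation. -/
noncomputable def incrError (L m : ℕ) (r : Fin R → Fin K) : ℝ :=
  if h : m < R then bonferroniError L (load r (r ⟨m, h⟩) m)
    + 1 / (K : ℝ) * ∑ j, bonferroniError L (load r j m) else 0

lemma incrError_nonneg (L m : ℕ) (r : Fin R → Fin K) : 0 ≤ incrError L m r := by
  unfold incrError
  split_ifs
  · exact add_nonneg (bonferroniError_nonneg _ _)
      (mul_nonneg (by positivity) (Finset.sum_nonneg fun _ _ => bonferroniError_nonneg _ _))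
  · exact le_rfl

lemma incrError_mem_lowDegree (L m : ℕ) : incrError L m ∈ lowDegree R K (1 + 2 * L + 1) := by
  by_cases h : m < R
  · have e : incrError (R := R) (K := K) L m = fun r => bonferroniError L (load r (r ⟨m, h⟩) m)
        + 1 / (K : ℝ) * ∑ j, bonferroniError L (load r j m) := by
      ext r
      simp only [incrError, dif_pos h]
    rw [e]
    exact (lowDegree R K _).add_mem
      (coord_mem_lowDegree ⟨m, h⟩ fun j => bonferroniError_mem_lowDegree L j m)
      (const_mul_mem_lowDegree _ (sum_mem_lowDegree _ fun j _ =>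
        lowDegree_mono (Nat.le_succ _) (bonferroniError_mem_lowDegree L j m)))
  · have e : incrError (R := R) (K := K) L m = fun _ => 0 := by
      ext r
      simp only [incrError, dif_neg h]
    rw [e]
    exact const_mem_lowDegree 0 _

lemma wavg_unif_incrError_le (hK : 0 < K) (hRK : (R : ℝ) ≤ (K : ℝ) / 20) (L m : ℕ) :
    wavg (unif R K) (incrError L m) ≤ 6 / 2 ^ L := by
  by_cases h : m < R
  · have := wavg_unif_sum_coord_le hK hRK (bonferroniError L) (1 / 2 ^ L) (by positivity)
      (fun n => (bonferroniError_le L n).trans_eq (by ring)) ⟨m, h⟩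
    rw [mul_one_div] at this
    have e : incrError (R := R) (K := K) L m = fun r => bonferroniError L (load r (r ⟨m, h⟩) m)
        + 1 / (K : ℝ) * ∑ j, bonferroniError L (load r j m) := by
      ext r
      simp only [incrError, dif_pos h]
    rw [e]
    exact this
  · have e : wavg (unif R K) (incrError L m) = 0 := by simp [wavg, incrError, h]
    rw [e]
    positivity

lemma abs_incr_sub_le (L m : ℕ) (r : Fin R → Fin K) :
    |incr nonzeroInd m r - incr (bonferroni L) m r| ≤ incrError L m r := by
  unfold incr incrError
  split_ifs with h
  · have h1 := abs_nonzeroInd_sub_bonferroni_le L (load r (r ⟨m, h⟩) m)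
    have h2 : |1 / (K : ℝ) * ∑ j, nonzeroInd (load r j m)
        - 1 / (K : ℝ) * ∑ j, bonferroni L (load r j m)|
        ≤ 1 / (K : ℝ) * ∑ j, bonferroniError L (load r j m) := by
      rw [← mul_sub, ← Finset.sum_sub_distrib, abs_mul, abs_of_nonneg (by positivity)]
      gcongr
      exact (Finset.abs_sum_le_sum_abs _ _).trans
        (Finset.sum_le_sum fun j _ => abs_nonzeroInd_sub_bonferroni_le L _)
    rw [sub_sub_sub_comm]
    exact (abs_sub _ _).trans (add_le_add h1 h2)
  · simp

lemma wavg_eq_of_mem_lowDegree {w : (Fin R → Fin K) → ℝ} {q : ℕ}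
    (hw : ∀ (h : Fin R → Fin K → ℝ) (s : Finset (Fin R)), s.card ≤ q → (∀ i ∉ s, h i = 1) →
      wavg w (fun r => ∏ i, h i (r i)) = ∏ i, (∑ j, h i j) / (K : ℝ))
    {f : (Fin R → Fin K) → ℝ} (hf : f ∈ lowDegree R K q) :
    wavg w f = wavg (unif R K) f := by
  induction hf using Submodule.span_induction with
  | mem f hf =>
    obtain ⟨h, s, hs, hh, rfl⟩ := hf
    rw [hw h s hs hh, wavg_unif_prod]
  | zero => simp [wavg]
  | add f g _ _ hf hg =>
    exact (wavg_add f g).trans ((congrArg₂ (· + ·) hf hg).trans (wavg_add f g).symm)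
  | smul c f _ hf =>
    exact (wavg_const_mul c f).trans ((congrArg (c * ·) hf).trans (wavg_const_mul c f).symm)

/-! ### The occupancy process -/

/-- The number of bins that are hit by the first `t` balls. -/
noncomputable def occupancy (r : Fin R → Fin K) (t : ℕ) : ℝ := ∑ j, nonzeroInd (load r j t)

lemma nonemptyBins_eq_occupancy (r : Fin R → Fin K) {t : ℕ} (ht : t ≤ R) :
    (nonemptyBins (fun i : Fin t => r (Fin.castLE ht i)) : ℝ) = occupancy r t := by
  rw [nonemptyBins, occupancy, Finset.card_filter]
  push_cast
  refine Finset.sum_congr rfl fun j _ => ?_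
  have h : (∃ i : Fin t, r (Fin.castLE ht i) = j) ↔ load r j t ≠ 0 := by
    rw [load, Finset.card_ne_zero]
    constructor
    · rintro ⟨i, hi⟩
      exact ⟨Fin.castLE ht i, by simp [hi]⟩
    · rintro ⟨i, hi⟩
      rw [Finset.mem_filter] at hi
      exact ⟨⟨i, hi.2.1⟩, hi.2.2⟩
  simp only [h, nonzeroInd, Nat.cast_eq_zero, ite_not]

lemma load_succ (r : Fin R → Fin K) (j : Fin K) {m : ℕ} (hm : m < R) :
    load r j (m + 1) = load r j m + if r ⟨m, hm⟩ = j then 1 else 0 := by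
  simp only [load, Finset.card_filter]
  rw [← Finset.sum_erase_add _ _ (Finset.mem_univ (⟨m, hm⟩ : Fin R)),
    ← Finset.sum_erase_add (a := (⟨m, hm⟩ : Fin R)) Finset.univ
      (fun i : Fin R => if i.val < m ∧ r i = j then 1 else 0) (Finset.mem_univ _)]
  simp only [lt_add_iff_pos_right, zero_lt_one, true_and, lt_irrefl, false_and, if_false, add_zero]
  congr 1
  refine Finset.sum_congr rfl fun i hi => ?_
  have : i.val ≠ m := fun h => (Finset.ne_of_mem_erase hi) (Fin.ext h)
  have : i.val < m + 1 ↔ i.val < m := by omega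
  simp only [this]

lemma occupancy_succ (r : Fin R → Fin K) {m : ℕ} (hm : m < R) :
    occupancy r (m + 1) = occupancy r m + 1 - nonzeroInd (load r (r ⟨m, hm⟩) m) := by
  have h (j : Fin K) : nonzeroInd (load r j (m + 1)) = nonzeroInd (load r j m)
      + if r ⟨m, hm⟩ = j then 1 - nonzeroInd (load r j m) else 0 := by
    rw [load_succ r j hm]
    split_ifs
    · have : (((load r j m + 1 : ℕ)) : ℝ) ≠ 0 := by positivity
      rw [nonzeroInd, if_neg this]
      ring
    · simp
  simp only [occupancy, h, Finset.sum_add_distrib, Finset.sum_ite_eq, Finset.mem_univ, if_true]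
  ring

lemma occupancy_zero (r : Fin R → Fin K) : occupancy r 0 = 0 := by
  simp [occupancy, load, nonzeroInd]

/-- By linearity: a given bin is missed by all `t` balls with probability `(1 - 1/K) ^ t`. -/
lemma expectedNonemptyBins_eq (hK : 0 < K) (t : ℕ) :
    expectedNonemptyBins K t = K * (1 - (1 - 1 / (K : ℝ)) ^ t) := by
  have hK' : (K : ℝ) ≠ 0 := by positivity
  have h (r : Fin t → Fin K) : (nonemptyBins r : ℝ) =
      ∑ j : Fin K, (1 - ∏ i, if r i = j then (0 : ℝ) else 1) := by
    rw [nonemptyBins, Finset.card_filter]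
    push_cast
    refine Finset.sum_congr rfl fun j _ => ?_
    split_ifs with hj
    · obtain ⟨i, hi⟩ := hj
      rw [Finset.prod_eq_zero (Finset.mem_univ i) (by simp [hi]), sub_zero]
    · push Not at hj
      simp [hj]
  have h2 (j : Fin K) : ∑ r : Fin t → Fin K, ∏ i, (if r i = j then (0 : ℝ) else 1)
      = ((K : ℝ) - 1) ^ t := by
    have := Finset.prod_univ_sum (fun _ : Fin t => (Finset.univ : Finset (Fin K)))
      (fun _ a => if a = j then (0 : ℝ) else 1)
    rw [Fintype.piFinset_univ] at this
    rw [← this, Finset.prod_const, Finset.card_univ, Fintype.card_fin]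
    congr 1
    have e (a : Fin K) : (if a = j then (0 : ℝ) else 1) = 1 - if a = j then 1 else 0 := by
      split_ifs <;> simp
    simp [e]
  rw [expectedNonemptyBins]
  simp only [h]
  rw [Finset.sum_comm]
  simp only [Finset.sum_sub_distrib, h2]
  have e : (1 - 1 / (K : ℝ)) = (K - 1) / K := by field_simp
  rw [e, div_pow]
  simp
  field_simp

/-- The deviation of the occupancy from its mean is controlled by the partial sums of `incr`. -/
lemma abs_occupancy_sub_le (hK : 0 < K) (hRK : (R : ℝ) ≤ (K : ℝ) / 20) (r : Fin R → Fin K)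
    {B : ℝ} (hB : ∀ t ≤ R, |∑ i ∈ Finset.range t, incr nonzeroInd i r| ≤ B) :
    ∀ t ≤ R, |occupancy r t - expectedNonemptyBins K t| ≤ 2 * B := by
  have hK' : (0 : ℝ) < K := by positivity
  have hB0 : 0 ≤ B := (abs_nonneg _).trans (hB 0 (Nat.zero_le _))
  -- The drift of the occupancy is `1 - occupancy / K`, and the mean obeys the same recursion
  -- without noise.
  have hrep : ∀ t ≤ R, occupancy r t - expectedNonemptyBins K t =
      -(∑ i ∈ Finset.range t, incr nonzeroInd i r) -
      1 / (K : ℝ) * ∑ i ∈ Finset.range t, (occupancy r i - expectedNonemptyBins K i) := by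
    intro t
    induction t with
    | zero => simp [occupancy_zero, expectedNonemptyBins_eq hK]
    | succ t ih =>
      intro ht
      have ih := ih (by omega)
      rw [Finset.sum_range_succ, Finset.sum_range_succ, occupancy_succ r ht, incr,
        dif_pos (show t < R from ht)]
      have e : expectedNonemptyBins K (t + 1) =
          1 + expectedNonemptyBins K t - 1 / (K : ℝ) * expectedNonemptyBins K t := by
        rw [expectedNonemptyBins_eq hK, expectedNonemptyBins_eq hK, pow_succ]
        field_simp
        ring
      rw [e]
      rw [← occupancy]
      linarith
  intro t
  induction t using Nat.strong_induction_on with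
  | _ t ih =>
    intro ht
    rw [hrep t ht]
    -- By the induction hypothesis each earlier deviation is at most `2 * B`; dividing by `K ≥ 20 R`
    -- leaves less than `B`.
    have h1 : |∑ i ∈ Finset.range t, (occupancy r i - expectedNonemptyBins K i)| ≤ R * (2 * B) := by
      calc _ ≤ ∑ i ∈ Finset.range t, |occupancy r i - expectedNonemptyBins K i| :=
            Finset.abs_sum_le_sum_abs _ _
        _ ≤ ∑ _i ∈ Finset.range t, 2 * B := Finset.sum_le_sum fun i hi =>
            ih i (Finset.mem_range.1 hi) ((Finset.mem_range.1 hi).le.trans ht)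
        _ = t * (2 * B) := by simp
        _ ≤ R * (2 * B) := by gcongr
    have h2 : |1 / (K : ℝ) * ∑ i ∈ Finset.range t, (occupancy r i - expectedNonemptyBins K i)|
        ≤ B := by
      rw [abs_mul, abs_of_pos (by positivity), one_div, ← div_eq_inv_mul, div_le_iff₀ hK']
      nlinarith
    have h3 := hB t ht
    rw [abs_le] at *
    constructor <;> linarith

end lowDegree

/-! ### Limited independence -/

section law

variable {R K : ℕ} {Ω : Type*} [MeasurableSpace Ω] {μ : Measure Ω} [IsProbabilityMeasure μ]
  {X : Fin R → Ω → Fin K}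

/-- The joint probability mass function of a family of random variables. -/
noncomputable def lawWeight (μ : Measure Ω) (X : Fin R → Ω → Fin K) (r : Fin R → Fin K) : ℝ :=
  μ.real {ω | (fun i => X i ω) = r}

lemma integral_eq_wavg_lawWeight (hX : ∀ i, Measurable (X i)) (f : (Fin R → Fin K) → ℝ) :
    ∫ ω, f (fun i => X i ω) ∂μ = wavg (lawWeight μ X) f := by
  have hZ : Measurable fun ω i => X i ω := measurable_pi_lambda _ hX
  have : IsProbabilityMeasure (μ.map fun ω i => X i ω) :=
    Measure.isProbabilityMeasure_map hZ.aemeasurable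
  rw [← integral_map (φ := fun ω i => X i ω) hZ.aemeasurable
    (Measurable.of_discrete).aestronglyMeasurable, integral_fintype .of_finite]
  refine Finset.sum_congr rfl fun r _ => ?_
  rw [map_measureReal_apply hZ (measurableSet_singleton r)]
  rfl

/-- Factors outside `s` are identically `1` on both sides, so independence of the subfamily `s`
suffices. -/
lemma wavg_lawWeight_prod (hK : 0 < K) (hX : ∀ i, Measurable (X i))
    (hunif : ∀ i, ∀ j : Fin K, μ.real {ω | X i ω = j} = 1 / (K : ℝ)) {q : ℕ}
    (hq : QWiseIndep q X μ) (h : Fin R → Fin K → ℝ) (s : Finset (Fin R)) (hs : s.card ≤ q)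
    (hh : ∀ i ∉ s, h i = 1) :
    wavg (lawWeight μ X) (fun r => ∏ i, h i (r i)) = ∏ i, (∑ j, h i j) / (K : ℝ) := by
  have hK' : (K : ℝ) ≠ 0 := by positivity
  have h1 (i : Fin R) : ∫ ω, h i (X i ω) ∂μ = (∑ j, h i j) / (K : ℝ) := by
    have : IsProbabilityMeasure (μ.map (X i)) :=
      Measure.isProbabilityMeasure_map (hX i).aemeasurable
    rw [← integral_map (hX i).aemeasurable (Measurable.of_discrete).aestronglyMeasurable,
      integral_fintype .of_finite, Finset.sum_div]
    refine Finset.sum_congr rfl fun j _ => ?_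
    rw [map_measureReal_apply (hX i) (measurableSet_singleton j), smul_eq_mul, div_eq_inv_mul,
      ← one_div, ← hunif i j]
    rfl
  rw [← integral_eq_wavg_lawWeight hX]
  have h2 (r : Fin R → Fin K) : ∏ i, h i (r i) = ∏ i : s, h i (r i) := by
    rw [Finset.prod_coe_sort s (fun i => h i (r i))]
    exact (Finset.prod_subset (Finset.subset_univ s) fun i _ hi => by rw [hh i hi]; rfl).symm
  simp only [h2]
  rw [(hq s hs).integral_fun_prod_comp (f := fun i : s => h i) (fun i => (hX i).aemeasurable)
    (fun i => (Measurable.of_discrete).aestronglyMeasurable)]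
  simp only [h1]
  rw [Finset.prod_coe_sort s (fun i => (∑ j, h i j) / (K : ℝ))]
  exact Finset.prod_subset (Finset.subset_univ s) fun i _ hi => by
    rw [hh i hi]
    simp [hK']

/-- The occupancy of `K` bins by `R` balls stays within `O(√R)` of its mean, provided that the
balls are sufficiently independent. -/
lemma occupancy_concentration (hR : 0 < R) (hRK : (R : ℝ) ≤ (K : ℝ) / 20)
    (hX : ∀ i, Measurable (X i))
    (hunif : ∀ i, ∀ j : Fin K, μ.real {ω | X i ω = j} = 1 / (K : ℝ)) (L : ℕ)
    (hL : (R : ℝ) ≤ 2 ^ L) (hq : QWiseIndep (4 * (L + 1)) X μ) :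
    3 / 4 ≤ μ.real {ω | ∀ (t : ℕ) (ht : t ≤ R),
      |(nonemptyBins (fun i : Fin t => X (Fin.castLE ht i) ω) : ℝ)
        - expectedNonemptyBins K t| ≤ 196 * Real.sqrt (R : ℝ)} := by
  classical
  have hR' : (1 : ℝ) ≤ R := by exact_mod_cast hR
  have hK : 0 < K := by
    have : (0 : ℝ) < K := by linarith
    exact_mod_cast this
  set w := lawWeight μ X with hw_def
  have hw : ∀ r, 0 ≤ w r := fun r => measureReal_nonneg
  have htransfer {f : (Fin R → Fin K) → ℝ} (hf : f ∈ lowDegree R K (4 * (L + 1))) :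
      wavg w f = wavg (unif R K) f :=
    wavg_eq_of_mem_lowDegree (wavg_lawWeight_prod hK hX hunif hq) hf
  have hfourth (a n : ℕ) :
      wavg w (fun r => (∑ i ∈ Finset.Ico a (a + n), incr (bonferroni L) i r) ^ 4) ≤
        768 * (n : ℝ) ^ 2 := by
    rw [htransfer (pow_mem_lowDegree
      (sum_mem_lowDegree _ fun i _ => incr_bonferroni_mem_lowDegree L i) 4)]
    exact wavg_unif_sum_incr_pow_four_le hK hRK L a n
  obtain ⟨G, hG, hEG⟩ := exists_maximal_fourth_moment hw (fun i => incr (bonferroni L) i) 768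
    hfourth (Nat.clog 2 R) 0
  -- The dyadic length is at most `2 R`, and `125 * 768 * 4 = 384000`.
  have hEG' : wavg w G ≤ 384000 * (R : ℝ) ^ 2 := by
    have h1 : 2 ^ Nat.clog 2 R ≤ 2 * R := by
      rcases Nat.lt_or_ge 1 R with h | h
      · have := Nat.pow_pred_clog_lt_self (by norm_num : 1 < 2) h
        have hpos := Nat.clog_pos (by norm_num : 1 < 2) h
        have e : 2 ^ Nat.clog 2 R = 2 ^ (Nat.clog 2 R).pred * 2 := by
          rw [← pow_succ, ← Nat.succ_eq_add_one, Nat.succ_pred_eq_of_pos hpos]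
        omega
      · rw [Nat.clog_of_right_le_one h]
        omega
    have h2 : ((2 : ℝ) ^ Nat.clog 2 R) ≤ 2 * R := by exact_mod_cast h1
    have h3 : (4 : ℝ) ^ Nat.clog 2 R = (2 ^ Nat.clog 2 R) ^ 2 := by
      rw [← pow_mul, mul_comm, pow_mul]
      norm_num
    have h4 : ((2 : ℝ) ^ Nat.clog 2 R) ^ 2 ≤ (2 * R) ^ 2 := pow_le_pow_left₀ (by positivity) h2 2
    rw [h3] at hEG
    nlinarith
  set Err : (Fin R → Fin K) → ℝ := fun r => ∑ m ∈ Finset.range R, incrError L m r with hErr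
  have hEErr : wavg w Err ≤ 6 := by
    rw [htransfer (sum_mem_lowDegree _ fun m _ =>
      lowDegree_mono (by omega) (incrError_mem_lowDegree L m)), wavg_sum]
    calc _ ≤ ∑ _m ∈ Finset.range R, (6 : ℝ) / 2 ^ L :=
          Finset.sum_le_sum fun m _ => wavg_unif_incrError_le hK hRK L m
      _ = R * (6 / 2 ^ L) := by simp
      _ ≤ 6 := by
        rw [mul_div_assoc', div_le_iff₀ (by positivity)]
        linarith
  have hErr0 (r) : 0 ≤ Err r := Finset.sum_nonneg fun m _ => incrError_nonneg L m r
  have hG0 (r) : 0 ≤ G r := (by positivity : (0 : ℝ) ≤ _ ^ 4).trans (hG r 0 (Nat.zero_le _))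
  let good : (Fin R → Fin K) → Prop := fun r => ∀ t ≤ R,
    |occupancy r t - expectedNonemptyBins K t| ≤ 196 * Real.sqrt (R : ℝ)
  -- Since `6250000 = 50 ^ 4` and `√R ≥ 1`, the partial sums are at most `50 √R + 48 ≤ 98 √R`;
  -- `abs_occupancy_sub_le` doubles this to `196 √R`.
  have hgood (r) (h1 : Err r ≤ 48) (h2 : G r ≤ 6250000 * (R : ℝ) ^ 2) : good r := by
    have hsq : Real.sqrt (R : ℝ) ^ 2 = R := Real.sq_sqrt (by positivity)
    have hsq1 : 1 ≤ Real.sqrt (R : ℝ) := Real.one_le_sqrt.2 hR'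
    have key : ∀ t ≤ R, |∑ i ∈ Finset.range t, incr nonzeroInd i r| ≤ 98 * Real.sqrt R := by
      intro t ht
      have h3 : |∑ i ∈ Finset.range t, incr (bonferroni L) i r| ≤ 50 * Real.sqrt R := by
        have h4 := (hG r t (ht.trans (Nat.le_pow_clog (by norm_num) R))).trans h2
        rw [zero_add, ← Finset.range_eq_Ico] at h4
        rw [← pow_le_pow_iff_left₀ (abs_nonneg _) (by positivity) four_ne_zero,
          Even.pow_abs (by decide)]
        calc _ ≤ _ := h4
          _ = 6250000 * (Real.sqrt (R : ℝ) ^ 2) ^ 2 := by rw [hsq]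
          _ = (50 * Real.sqrt R) ^ 4 := by ring
      have h5 : |∑ i ∈ Finset.range t, incr nonzeroInd i r
          - ∑ i ∈ Finset.range t, incr (bonferroni L) i r| ≤ 48 := by
        rw [← Finset.sum_sub_distrib]
        calc _ ≤ ∑ i ∈ Finset.range t, |incr nonzeroInd i r - incr (bonferroni L) i r| :=
              Finset.abs_sum_le_sum_abs _ _
          _ ≤ ∑ i ∈ Finset.range t, incrError L i r :=
              Finset.sum_le_sum fun i _ => abs_incr_sub_le L i r
          _ ≤ Err r := Finset.sum_le_sum_of_subset_of_nonneg (Finset.range_mono ht)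
              fun i _ _ => incrError_nonneg L i r
          _ ≤ 48 := h1
      rw [abs_le] at *
      constructor <;> linarith
    intro t ht
    exact (abs_occupancy_sub_le hK hRK r key t ht).trans_eq (by ring)
  have hmeas : MeasurableSet {ω | good fun i => X i ω} :=
    measurable_pi_lambda _ hX (Set.toFinite {r | good r}).measurableSet
  have hevent : {ω | ∀ (t : ℕ) (ht : t ≤ R),
      |(nonemptyBins (fun i : Fin t => X (Fin.castLE ht i) ω) : ℝ)
        - expectedNonemptyBins K t| ≤ 196 * Real.sqrt (R : ℝ)} = {ω | good fun i => X i ω} := by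
    ext ω
    refine forall_congr' fun t => forall_congr' fun ht => ?_
    rw [← nonemptyBins_eq_occupancy (fun i => X i ω) ht]
  have hind : μ.real {ω | good fun i => X i ω} =
      wavg w (fun r => if good r then (1 : ℝ) else 0) := by
    rw [hw_def, ← integral_eq_wavg_lawWeight hX, ← integral_indicator_one hmeas]
    simp only [Set.indicator_apply, Set.mem_ofPred_eq, Pi.one_apply]
  have hone : wavg w (fun _ => (1 : ℝ)) = 1 := by
    rw [hw_def, ← integral_eq_wavg_lawWeight hX]
    simp
  -- Markov's inequality and the union bound in one pointwise estimate; each error term has mean at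
  -- most `1/8`.
  have hlower : wavg w (fun r => 1 + (-(1 / 48) * Err r + -(1 / (6250000 * (R : ℝ) ^ 2)) * G r)) ≤
      wavg w (fun r => if good r then (1 : ℝ) else 0) := by
    refine wavg_mono hw fun r => ?_
    have hc : (0 : ℝ) < 6250000 * (R : ℝ) ^ 2 := by positivity
    have a1 := hErr0 r
    have a2 : 0 ≤ 1 / (6250000 * (R : ℝ) ^ 2) * G r := mul_nonneg (by positivity) (hG0 r)
    split_ifs with hr
    · linarith
    · by_cases b1 : Err r ≤ 48
      · have b2 : 6250000 * (R : ℝ) ^ 2 < G r := not_le.1 fun b2 => hr (hgood r b1 b2)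
        have : 1 < 1 / (6250000 * (R : ℝ) ^ 2) * G r := by
          rw [one_div, ← div_eq_inv_mul, lt_div_iff₀ hc]
          linarith
        linarith
      · linarith [not_le.1 b1]
  rw [wavg_add, wavg_add, wavg_const_mul, wavg_const_mul, hone] at hlower
  have hGfinal : 1 / (6250000 * (R : ℝ) ^ 2) * wavg w G ≤ 1 / 8 := by
    rw [one_div, ← div_eq_inv_mul, div_le_iff₀ (by positivity)]
    nlinarith [sq_nonneg (R : ℝ)]
  rw [hevent, hind]
  linarith

end law

theorem mainTheorem7 :
    ∃ (q : ℕ → ℕ) (A : ℕ) (C : ℝ),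
      (fun R : ℕ => (q R : ℝ)) =Θ[atTop] (fun R : ℕ => (Real.log (R : ℝ)) ^ A) ∧
      ∀ (R K : ℕ), (R : ℝ) ≤ (K : ℝ) / 20 →
      ∀ (Ω : Type*) [MeasurableSpace Ω] (μ : Measure Ω) [IsProbabilityMeasure μ]
        (X : Fin R → Ω → Fin K),
        (∀ i, Measurable (X i)) →
        (∀ i, ∀ j : Fin K, μ.real {ω | X i ω = j} = 1 / (K : ℝ)) →
        QWiseIndep (q R) X μ →
        3 / 4 ≤ μ.real {ω | ∀ (t : ℕ) (ht : t ≤ R),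
          |(nonemptyBins (fun i : Fin t => X (Fin.castLE ht i) ω) : ℝ)
            - expectedNonemptyBins K t| ≤ C * Real.sqrt (R : ℝ)} := by
  -- With `L = 2 * ⌈log R⌉₊`, `2 ^ L = 4 ^ ⌈log R⌉₊ ≥ R` because `e < 4`; so `A = 1` suffices.
  refine ⟨fun R => 4 * (2 * ⌈Real.log R⌉₊ + 1), 1, 196, ?_, ?_⟩
  · have hlog : ∀ᶠ R : ℕ in atTop, 1 ≤ Real.log (R : ℝ) :=
      (Real.tendsto_log_atTop.comp tendsto_natCast_atTop_atTop).eventually_ge_atTop 1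
    refine ⟨IsBigO.of_bound 20 ?_, IsBigO.of_bound 1 ?_⟩
    · filter_upwards [hlog] with R hR
      have := Nat.ceil_lt_add_one (zero_le_one.trans hR)
      rw [pow_one, Real.norm_of_nonneg (by positivity), Real.norm_of_nonneg (by linarith)]
      push_cast
      linarith
    · filter_upwards [hlog] with R hR
      have := Nat.le_ceil (Real.log R)
      rw [pow_one, Real.norm_of_nonneg (by linarith), Real.norm_of_nonneg (by positivity)]
      push_cast
      linarith
  · intro R K hRK Ω _ μ _ X hX hunif hq
    -- The case `R = 0` is separate because it permits `K = 0`, and because `√R ≥ 1` fails.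
    rcases Nat.eq_zero_or_pos R with rfl | hR
    · have : {ω : Ω | ∀ (t : ℕ) (ht : t ≤ 0),
          |(nonemptyBins (fun i : Fin t => X (Fin.castLE ht i) ω) : ℝ)
            - expectedNonemptyBins K t| ≤ 196 * Real.sqrt ((0 : ℕ) : ℝ)} = Set.univ := by
        refine Set.eq_univ_of_forall fun ω t ht => ?_
        obtain rfl := Nat.le_zero.1 ht
        simp [nonemptyBins, expectedNonemptyBins]
      rw [this, probReal_univ]
      norm_num
    · refine occupancy_concentration hR hRK hX hunif (2 * ⌈Real.log R⌉₊) ?_ hq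
      have hR' : (0 : ℝ) < R := by positivity
      calc (R : ℝ) = Real.exp (Real.log R) := (Real.exp_log hR').symm
        _ ≤ Real.exp (⌈Real.log R⌉₊ * 1) := by
          rw [mul_one]
          exact Real.exp_le_exp.2 (Nat.le_ceil _)
        _ = Real.exp 1 ^ ⌈Real.log R⌉₊ := Real.exp_nat_mul _ _
        _ ≤ (2 ^ 2) ^ ⌈Real.log R⌉₊ := by
          refine pow_le_pow_left₀ (Real.exp_pos _).le ?_ _
          linarith [Real.exp_one_lt_three]
        _ = 2 ^ (2 * ⌈Real.log R⌉₊) := (pow_mul _ _ _).symm
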